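/- Let $n\ge 2$, let $r\in\mathbb N\cup\{\infty\}$ with $r\ge n$ (for example $r=\infty$), let $G\subseteq\mathbb R^n$ be an open neighbourhood of the origin, and let $F:G\to\mathbb R$ be a function of class $C^r$ with $F(0)=0$. Suppose that the origin is an isolated connected component of the level set $F^{-1}(0)$, i.e. $\{0\}$ is a connected component of $F^{-1}(0)$ and there is an open set $U\ni 0$ with $U\cap F^{-1}(0)=\{0\}$. Then $F$ satisfies condition $\mathbf L$: there are a sequence $(a_i)$ of regular values of $F$ (i.e. $dF(x)\neq 0$ for every $x\in G$ with $F(x)=a_i$) converging to $0$ and, for each $i$, a connected component $H_i$ of $F^{-1}(a_i)$, such that each $H_i$ is a connected compact embedded $(n-1)$-dimensional submanifold of $\mathbb R^n$ of class $C^r$ which restricts the origin (i.e. $0\notin H_i$ and $H_i$ is the boundary of a compact set $K_i\subset\mathbb R^n$ with $0\in K_i$), and $\operatorname{diam} H_i\to 0$ as $i\to\infty$. -/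

import Mathlib

open Filter Topology
open scoped ContDiff

/-- The level set `F⁻¹(a)` of a function `F` given on `G ⊆ ℝⁿ`. -/
def levelSet {n : ℕ} (G : Set (EuclideanSpace ℝ (Fin n)))
    (F : EuclideanSpace ℝ (Fin n) → ℝ) (a : ℝ) : Set (EuclideanSpace ℝ (Fin n)) :=
  {x | x ∈ G ∧ F x = a}

/-- `a` is a regular value of `F` on the open set `G`: the differential of `F` is nonzero
(that is, onto `ℝ`) at every point of the level set. -/
def IsRegularValueOn {n : ℕ} (G : Set (EuclideanSpace ℝ (Fin n)))
    (F : EuclideanSpace ℝ (Fin n) → ℝ) (a : ℝ) : Prop :=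
  ∀ x ∈ levelSet G F a, fderiv ℝ F x ≠ 0

/-- `C` is a connected component of the set `S`. -/
def IsConnectedComponentOf {X : Type*} [TopologicalSpace X] (C S : Set X) : Prop :=
  ∃ x ∈ S, C = connectedComponentIn S x

/-- `C` is an isolated connected component of `S`: a connected component that has a
neighbourhood containing no other points of `S`. -/
def IsIsolatedComponentOf {X : Type*} [TopologicalSpace X] (C S : Set X) : Prop :=
  IsConnectedComponentOf C S ∧ ∃ U : Set X, IsOpen U ∧ C ⊆ U ∧ U ∩ S = C

/-- `S` is an embedded `(n-1)`-dimensional submanifold (without boundary) of `ℝⁿ` of class `C^r`: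
around each of its points there is a `C^r` chart of `ℝⁿ` in which `S` becomes the
vanishing locus of one of the coordinates. -/
def IsHypersurface {n : ℕ} (r : ℕ∞) (S : Set (EuclideanSpace ℝ (Fin n))) : Prop :=
  ∀ p ∈ S, ∃ (φ : OpenPartialHomeomorph (EuclideanSpace ℝ (Fin n)) (EuclideanSpace ℝ (Fin n)))
    (j : Fin n), p ∈ φ.source ∧
      ContDiffOn ℝ (r : WithTop ℕ∞) φ φ.source ∧
      ContDiffOn ℝ (r : WithTop ℕ∞) φ.symm φ.target ∧
      ∀ x ∈ φ.source, x ∈ S ↔ φ x j = 0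

/-- `H ⊆ G` restricts (limits) the origin: `H` does not contain the origin and is the boundary of
a compact set containing the origin. -/
def RestrictsOrigin {n : ℕ} (G H : Set (EuclideanSpace ℝ (Fin n))) : Prop :=
  H ⊆ G ∧ (0 : EuclideanSpace ℝ (Fin n)) ∉ H ∧
    ∃ K : Set (EuclideanSpace ℝ (Fin n)), IsCompact K ∧ 0 ∈ K ∧ frontier K = H

/-- Condition **L** for a function `F` of class `C^r` on a neighbourhood `G` of the origin:
there are regular values `a i → 0` and connected components `H i` of the level sets of the
values `a i` that are connected compact hypersurfaces restricting the origin, with diameters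
tending to `0`. -/
def ConditionL {n : ℕ} (r : ℕ∞) (G : Set (EuclideanSpace ℝ (Fin n)))
    (F : EuclideanSpace ℝ (Fin n) → ℝ) : Prop :=
  ∃ (a : ℕ → ℝ) (H : ℕ → Set (EuclideanSpace ℝ (Fin n))),
    (∀ i, IsRegularValueOn G F (a i)) ∧
    Tendsto a atTop (𝓝 0) ∧
    (∀ i, IsConnectedComponentOf (H i) (levelSet G F (a i)) ∧
      IsConnected (H i) ∧ IsCompact (H i) ∧ IsHypersurface r (H i) ∧
      RestrictsOrigin G (H i)) ∧
    Tendsto (fun i => Metric.diam (H i)) atTop (𝓝 0)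

/-! For `n ≥ 2` a punctured ball around the origin is connected, so `F`, having no zero there, has
constant sign; after replacing `F` by `-F` it is positive. On a small sphere `F` then has a positive
minimum, and every positive `a` below it traps the component `V` of `{F < a}` around `0` inside the
ball. Let `W` be the component of the complement of `closure V` that contains the outside of the
ball. The hypersurface is `H = frontier W`, and `Wᶜ`, which is `closure V` with its holes filled, is
the compact set that it bounds.

Connectedness of `H` is unicoherence of `ℝⁿ` (`isPreconnected_inter_of_union_eq_univ`), applied to
`closure W` and `Wᶜ`. If `a` is a regular value, the level set near a point of `H` separates a piece
of `V` from a piece of `W`; hence it lies in `H`, and `H` is a whole component of the level set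
(`exists_component_of_regular_value`).

Arbitrarily small regular values come from the Morse–Sard theorem (`volume_image_critical_eq_zero`),
where `r ≥ n` enters. The critical set is cut into countably many pieces of dimension `d ≤ n` along
which `F` varies by `o(‖y - x‖ ^ n)`; the image of such a piece is null. -/

/-! ### Connectedness of complements, and unicoherence. -/

theorem isPreconnected_compl_connectedComponentIn_compl {X : Type*} [TopologicalSpace X]
    [LocallyConnectedSpace X] [PreconnectedSpace X] {S : Set X} (hS : IsConnected S)
    (hSc : IsClosed S) (x : X) : IsPreconnected (connectedComponentIn Sᶜ x)ᶜ := by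
  obtain ⟨s, hs⟩ := hS.nonempty
  have hsub : ∀ z, S ⊆ (connectedComponentIn Sᶜ z)ᶜ := fun z y hy hy' =>
    connectedComponentIn_subset _ _ hy' hy
  refine isPreconnected_of_forall s fun y hy => ?_
  by_cases hyS : y ∈ S
  · exact ⟨S, hsub x, hs, hyS, hS.isPreconnected⟩
  have hyC : y ∈ connectedComponentIn Sᶜ y := mem_connectedComponentIn hyS
  have hopen : ∀ z, IsOpen (connectedComponentIn Sᶜ z) := fun z =>
    hSc.isOpen_compl.connectedComponentIn
  have hdisj : Disjoint (connectedComponentIn Sᶜ y) (connectedComponentIn Sᶜ x) := by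
    rw [Set.disjoint_left]
    intro z hz hz'
    exact hy (by rwa [connectedComponentIn_eq hz', ← connectedComponentIn_eq hz])
  have hcl : closure (connectedComponentIn Sᶜ y) ⊆ (connectedComponentIn Sᶜ x)ᶜ :=
    closure_minimal hdisj.subset_compl_right (hopen x).isClosed_compl
  -- Otherwise the component of `y` in `Sᶜ` would be clopen, hence the whole space, although it
  -- misses `S`.
  have hfr : (S ∩ closure (connectedComponentIn Sᶜ y)).Nonempty := by
    by_contra hne
    have hclosed : IsClosed (connectedComponentIn Sᶜ y) := by
      refine isClosed_of_closure_subset fun z hz => ?_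
      have hzS : z ∈ Sᶜ := fun h => hne ⟨z, h, hz⟩
      obtain ⟨w, hw, hw'⟩ := mem_closure_iff.1 hz _ (hopen z) (mem_connectedComponentIn hzS)
      rw [connectedComponentIn_eq hw', ← connectedComponentIn_eq hw]
      exact mem_connectedComponentIn hzS
    have huniv := IsClopen.eq_univ ⟨hclosed, hopen y⟩ ⟨y, hyC⟩
    exact hsub y hs (huniv ▸ Set.mem_univ s)
  refine ⟨S ∪ closure (connectedComponentIn Sᶜ y), Set.union_subset (hsub x) hcl, Or.inl hs,
    Or.inr (subset_closure hyC), ?_⟩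
  exact IsPreconnected.union' hfr hS.isPreconnected isPreconnected_connectedComponentIn.closure

/-- A splitting of `A ∩ B` would give a circle-valued map winding once along a loop through `A` and
back through `B`; simple connectedness lifts this map to `ℝ`, which is impossible. -/
theorem isPreconnected_inter_of_union_eq_univ {X : Type*} [TopologicalSpace X] [NormalSpace X]
    [SimplyConnectedSpace X] [LocallyPathConnectedSpace X] {A B : Set X}
    (hA : IsClosed A) (hB : IsClosed B) (hA' : IsPreconnected A) (hB' : IsPreconnected B)
    (hAB : A ∪ B = Set.univ) : IsPreconnected (A ∩ B) := by
  classical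
  rw [isPreconnected_closed_iff]
  rintro t t' ht ht' hcov ⟨p, hp, hpt⟩ ⟨q, hq, hqt⟩
  by_contra hne
  obtain ⟨u, hu0, hu1, -⟩ := exists_continuous_zero_one_of_isClosed
    ((hA.inter hB).inter ht) ((hA.inter hB).inter ht')
    (Set.disjoint_left.2 fun z hz hz' => hne ⟨z, hz.1, hz.2, hz'.2⟩)
  have hu : Continuous u := u.continuous
  have hhalf : ((1 / 2 : ℝ) : AddCircle (1 : ℝ)) = ((-(1 / 2) : ℝ) : AddCircle (1 : ℝ)) := by
    rw [← AddCircle.coe_add_period (1 : ℝ) (-(1 / 2))]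
    norm_num
  -- The two formulas agree on `A ∩ B`: there `u` is `0` or `1`, and `1/2 = -1/2` modulo `1`.
  let g : X → AddCircle (1 : ℝ) := fun x =>
    if x ∈ A then ((u x / 2 : ℝ) : AddCircle (1 : ℝ)) else ((-(u x / 2) : ℝ) : AddCircle (1 : ℝ))
  have hgA : ∀ x ∈ A, g x = ((u x / 2 : ℝ) : AddCircle (1 : ℝ)) := fun x hx => if_pos hx
  have hgB : ∀ x ∈ B, g x = ((-(u x / 2) : ℝ) : AddCircle (1 : ℝ)) := by
    intro x hx
    by_cases hxA : x ∈ A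
    · rw [hgA x hxA]
      rcases hcov ⟨hxA, hx⟩ with h | h
      · simp [show u x = 0 from hu0 ⟨⟨hxA, hx⟩, h⟩]
      · rw [show u x = 1 from hu1 ⟨⟨hxA, hx⟩, h⟩, hhalf]
    · exact if_neg hxA
  have hcoe : Continuous ((↑) : ℝ → AddCircle (1 : ℝ)) := AddCircle.continuous_mk' 1
  have hg : Continuous g := by
    rw [← continuousOn_univ, ← hAB]
    refine ContinuousOn.union_of_isClosed ?_ ?_ hA hB
    · exact (hcoe.comp (hu.div_const 2)).continuousOn.congr hgA
    · exact (hcoe.comp (hu.div_const 2).neg).continuousOn.congr hgB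
  obtain ⟨θ, ⟨-, hθ⟩, -⟩ := (AddCircle.isCoveringMap_coe (1 : ℝ)).existsUnique_continuousMap_lifts
    ⟨g, hg⟩ p (u p / 2) (hgA p hp.1).symm
  have hθ' : ∀ x, ((θ x : ℝ) : AddCircle (1 : ℝ)) = g x := fun x => congrFun hθ x
  have hint : ∀ a b : ℝ, (a : AddCircle (1 : ℝ)) = b → a - b ∈ Set.range ((↑) : ℤ → ℝ) := by
    intro a b hab
    obtain ⟨k, hk⟩ := (AddCircle.coe_eq_zero_iff 1).1
      (show ((a - b : ℝ) : AddCircle (1 : ℝ)) = 0 by rw [AddCircle.coe_sub, hab, sub_self])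
    exact ⟨k, by simpa using hk⟩
  have hdisc : IsDiscrete (Set.range ((↑) : ℤ → ℝ)) :=
    Int.isClosedEmbedding_coe_real.isEmbedding.isDiscrete_range
  -- From `p` to `q` the lift rises by `1/2` when compared on `A` and falls by `1/2` when compared
  -- on `B`.
  have h1 : θ p - u p / 2 = θ q - u q / 2 :=
    hA'.constant_of_mapsTo (T := Set.range ((↑) : ℤ → ℝ)) (f := fun x => θ x - u x / 2)
      hdisc (by fun_prop) (fun x hx => hint _ _ ((hθ' x).trans (hgA x hx))) hp.1 hq.1
  have h2 : θ p - -(u p / 2) = θ q - -(u q / 2) :=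
    hB'.constant_of_mapsTo (T := Set.range ((↑) : ℤ → ℝ)) (f := fun x => θ x - -(u x / 2))
      hdisc (by fun_prop) (fun x hx => hint _ _ ((hθ' x).trans (hgB x hx))) hp.2 hq.2
  have hup : u p = 0 := hu0 ⟨hp, hpt⟩
  have huq : u q = 1 := hu1 ⟨hq, hqt⟩
  rw [hup, huq] at h1 h2
  linarith

/-! ### Charts straightening a regular level set. -/

theorem exists_single_ne_zero {n : ℕ} {L : EuclideanSpace ℝ (Fin n) →L[ℝ] ℝ} (hL : L ≠ 0) :
    ∃ j, L (EuclideanSpace.single j 1) ≠ 0 := by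
  by_contra! h
  refine hL (ContinuousLinearMap.coe_injective
    ((EuclideanSpace.basisFun (Fin n) ℝ).toBasis.ext fun j => ?_))
  simpa using h j

theorem exists_chart_of_partial_ne_zero {n : ℕ} {k : WithTop ℕ∞} (hk : 1 ≤ k)
    {U : Set (EuclideanSpace ℝ (Fin n))} (hU : IsOpen U) {g : EuclideanSpace ℝ (Fin n) → ℝ}
    (hg : ContDiffOn ℝ k g U) {p : EuclideanSpace ℝ (Fin n)} (hp : p ∈ U) {j : Fin n}
    (hj : fderiv ℝ g p (EuclideanSpace.single j 1) ≠ 0) :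
    ∃ φ : OpenPartialHomeomorph (EuclideanSpace ℝ (Fin n)) (EuclideanSpace ℝ (Fin n)),
      p ∈ φ.source ∧ φ.source ⊆ U ∧ ContDiffOn ℝ k φ φ.source ∧
      ContDiffOn ℝ k φ.symm φ.target ∧
      ∀ x ∈ φ.source, φ x j = g x ∧ ∀ i ≠ j, φ x i = x i := by
  set e : EuclideanSpace ℝ (Fin n) := EuclideanSpace.single j 1 with he
  let pr : EuclideanSpace ℝ (Fin n) →L[ℝ] ℝ := EuclideanSpace.proj j
  -- Replaces the `j`-th coordinate by `g` and keeps the others.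
  let f : EuclideanSpace ℝ (Fin n) → EuclideanSpace ℝ (Fin n) := fun x => x + (g x - pr x) • e
  have hfU : ContDiffOn ℝ k f U :=
    contDiffOn_id.add ((hg.sub pr.contDiff.contDiffOn).smul contDiffOn_const)
  have hequiv : ∀ x ∈ U, fderiv ℝ g x e ≠ 0 →
      ∃ T : EuclideanSpace ℝ (Fin n) ≃L[ℝ] EuclideanSpace ℝ (Fin n),
        HasFDerivAt f (T : EuclideanSpace ℝ (Fin n) →L[ℝ] EuclideanSpace ℝ (Fin n)) x := by
    intro x hx hne
    have hd : HasFDerivAt g (fderiv ℝ g x) x :=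
      ((hg.contDiffAt (hU.mem_nhds hx)).differentiableAt (by positivity)).hasFDerivAt
    let T : EuclideanSpace ℝ (Fin n) →L[ℝ] EuclideanSpace ℝ (Fin n) :=
      ContinuousLinearMap.id ℝ _ + (fderiv ℝ g x - pr).smulRight e
    have hT : HasFDerivAt f T x :=
      (hasFDerivAt_id x).add ((hd.sub pr.hasFDerivAt).smul_const e)
    have hinj : Function.Injective T := by
      rw [injective_iff_map_eq_zero]
      intro v hv
      have hv' : v + (fderiv ℝ g x v - v j) • e = 0 := hv
      have h1 : fderiv ℝ g x v = 0 := by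
        have := congrArg (fun w : EuclideanSpace ℝ (Fin n) => w j) hv'
        simpa [he] using this
      rw [h1, zero_sub, neg_smul, ← sub_eq_add_neg, sub_eq_zero] at hv'
      rw [hv', map_smul, smul_eq_mul] at h1
      rw [hv', (mul_eq_zero.1 h1).resolve_right hne, zero_smul]
    refine ⟨(LinearEquiv.ofInjectiveEndo T.toLinearMap hinj).toContinuousLinearEquiv, ?_⟩
    exact hT
  obtain ⟨T, hT⟩ := hequiv p hp hj
  have hk0 : k ≠ 0 := by positivity
  let φ₀ := (hfU.contDiffAt (hU.mem_nhds hp)).toOpenPartialHomeomorph f hT hk0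
  -- Restricting to this set keeps the derivative of `f` invertible at every point of the source, so
  -- the inverse is `C^k` on the whole target.
  have hopen : IsOpen (U ∩ {x | fderiv ℝ g x e ≠ 0}) :=
    ((hg.continuousOn_fderiv_of_isOpen hU hk).clm_apply continuousOn_const).isOpen_inter_preimage
      hU isOpen_compl_singleton
  let φ := φ₀.restrOpen _ hopen
  have hsrc : ∀ x ∈ φ.source, x ∈ U ∧ fderiv ℝ g x e ≠ 0 := fun x hx => by
    rw [OpenPartialHomeomorph.restrOpen_source] at hx
    exact hx.2
  have hφ : ∀ x, φ x = f x := fun x => rfl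
  refine ⟨φ, ?_, fun x hx => (hsrc x hx).1, ?_, ?_, ?_⟩
  · rw [OpenPartialHomeomorph.restrOpen_source]
    exact ⟨ContDiffAt.mem_toOpenPartialHomeomorph_source _ hT hk0, hp, hj⟩
  · exact hfU.mono fun x hx => (hsrc x hx).1
  · intro y hy
    have hx := hsrc _ (φ.map_target hy)
    obtain ⟨T', hT'⟩ := hequiv _ hx.1 hx.2
    exact (φ.contDiffAt_symm hy hT' (hfU.contDiffAt (hU.mem_nhds hx.1))).contDiffWithinAt
  · intro x hx
    rw [hφ]
    refine ⟨?_, fun i hi => ?_⟩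
    · simp [f, pr, he]
    · simp [f, he, hi]

/-- In the chart, each side of the level set is a half of a ball, hence convex. The sign of `s`
selects the side. -/
theorem exists_nhds_isPreconnected_sides {n : ℕ} {O : Set (EuclideanSpace ℝ (Fin n))}
    (hO : IsOpen O) {g : EuclideanSpace ℝ (Fin n) → ℝ} (hg : ContDiffOn ℝ 1 g O)
    {p : EuclideanSpace ℝ (Fin n)} (hp : p ∈ O) (hgp : fderiv ℝ g p ≠ 0) :
    ∃ N, IsOpen N ∧ p ∈ N ∧ N ⊆ O ∧ ∀ s : ℝ, s ≠ 0 →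
      IsPreconnected (N ∩ {x | 0 < s * g x}) ∧
      N ∩ {x | g x = 0} ⊆ closure (N ∩ {x | 0 < s * g x}) := by
  obtain ⟨j, hj⟩ := exists_single_ne_zero hgp
  obtain ⟨φ, hpφ, hφO, -, -, hφ⟩ := exists_chart_of_partial_ne_zero le_rfl hO hg hp hj
  obtain ⟨δ, hδ, hball⟩ := Metric.isOpen_iff.1 φ.open_target _ (φ.map_source hpφ)
  have hN : IsOpen (φ.source ∩ φ ⁻¹' Metric.ball (φ p) δ) :=
    φ.isOpen_inter_preimage Metric.isOpen_ball
  have hpN : φ p ∈ Metric.ball (φ p) δ := Metric.mem_ball_self hδ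
  have hNO : φ.source ∩ φ ⁻¹' Metric.ball (φ p) δ ⊆ O := fun x hx => hφO hx.1
  refine ⟨φ.source ∩ φ ⁻¹' Metric.ball (φ p) δ, hN, ⟨hpφ, hpN⟩, hNO, fun s hs => ⟨?_, ?_⟩⟩
  · have himg : φ.source ∩ φ ⁻¹' Metric.ball (φ p) δ ∩ {x | 0 < s * g x} =
        φ.symm '' (Metric.ball (φ p) δ ∩ {y | 0 < s * y j}) := by
      ext x
      constructor
      · rintro ⟨⟨hx, hxb⟩, hxs⟩
        exact ⟨φ x, ⟨hxb, by simpa [(hφ x hx).1] using hxs⟩, φ.left_inv hx⟩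
      · rintro ⟨y, ⟨hy, hys⟩, rfl⟩
        have hs' := φ.map_target (hball hy)
        refine ⟨⟨hs', ?_⟩, ?_⟩
        · simpa [φ.right_inv (hball hy)] using hy
        · simpa [← (hφ _ hs').1, φ.right_inv (hball hy)] using hys
    rw [himg]
    refine IsPreconnected.image (Convex.isPreconnected ?_) _
      (φ.symm.continuousOn.mono (Set.inter_subset_left.trans hball))
    refine (convex_ball _ _).inter ?_
    exact convex_halfSpace_gt (f := fun y : EuclideanSpace ℝ (Fin n) => s * y j)
      ⟨fun x y => by simp [mul_add], fun c x => by simp; ring⟩ 0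
  · rintro q ⟨⟨hq, hqb⟩, hq0⟩
    -- Along this line `g` equals `s * t`, so `s * g = s² t` is positive for `t > 0` whatever the
    -- sign of `s`.
    let γ : ℝ → EuclideanSpace ℝ (Fin n) := fun t => φ q + (s * t) • EuclideanSpace.single j 1
    have hγ : Continuous γ := by fun_prop
    have hγ0 : γ 0 = φ q := by simp [γ]
    have hlim : Tendsto (fun t => φ.symm (γ t)) (𝓝[>] 0) (𝓝 q) := by
      have h1 : ContinuousAt (fun t => φ.symm (γ t)) 0 :=
        ContinuousAt.comp (g := φ.symm)
          (by rw [hγ0]; exact φ.continuousAt_symm (φ.map_source hq)) hγ.continuousAt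
      have h2 := h1.tendsto
      rw [hγ0, φ.left_inv hq] at h2
      exact h2.mono_left nhdsWithin_le_nhds
    refine mem_closure_of_tendsto hlim ?_
    have hev : ∀ᶠ t in 𝓝[>] (0 : ℝ), γ t ∈ Metric.ball (φ p) δ :=
      nhdsWithin_le_nhds (hγ.continuousAt.eventually
        (by rw [hγ0]; exact Metric.isOpen_ball.mem_nhds hqb))
    filter_upwards [hev, self_mem_nhdsWithin] with t ht htpos
    have htpos' : 0 < t := htpos
    have hs' := φ.map_target (hball ht)
    refine ⟨⟨hs', ?_⟩, ?_⟩
    · simpa [φ.right_inv (hball ht)] using ht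
    · have hqj : φ q j = 0 := (hφ q hq).1.trans hq0
      have : g (φ.symm (γ t)) = s * t := by
        rw [← (hφ _ hs').1, φ.right_inv (hball ht)]
        simp [γ, hqj]
      change 0 < s * g (φ.symm (γ t))
      rw [this]
      have := mul_pos (mul_self_pos.2 hs) htpos'
      linarith

/-! ### Connectedness of punctured balls and of complements of balls. -/

theorem one_lt_rank_euclideanSpace {n : ℕ} (hn : 2 ≤ n) :
    1 < Module.rank ℝ (EuclideanSpace ℝ (Fin n)) := by
  rw [rank_eq_card_basis (EuclideanSpace.basisFun (Fin n) ℝ).toBasis]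
  simpa [← Nat.succ_le_iff] using hn

theorem isPreconnected_norm_preimage {E : Type*} [NormedAddCommGroup E] [NormedSpace ℝ E]
    (h : 1 < Module.rank ℝ E) {S : Set ℝ} (hS : IsPreconnected S) (hpos : S ⊆ Set.Ioi 0) :
    IsPreconnected {x : E | ‖x‖ ∈ S} := by
  have himg : {x : E | ‖x‖ ∈ S} =
      (fun q : ℝ × E => q.1 • q.2) '' (S ×ˢ Metric.sphere 0 1) := by
    ext x
    constructor
    · intro hx
      have hx0 : ‖x‖ ≠ 0 := (hpos hx).ne'
      refine ⟨(‖x‖, ‖x‖⁻¹ • x), ⟨hx, ?_⟩, smul_inv_smul₀ hx0 x⟩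
      rw [mem_sphere_zero_iff_norm, norm_smul, norm_inv, norm_norm, inv_mul_cancel₀ hx0]
    · rintro ⟨⟨t, y⟩, ⟨ht, hy⟩, rfl⟩
      rw [Set.mem_ofPred_eq, norm_smul, mem_sphere_zero_iff_norm.1 hy, mul_one,
        Real.norm_of_nonneg (le_of_lt (hpos ht))]
      exact ht
  rw [himg]
  exact (hS.prod (isPreconnected_sphere h 0 1)).image _ (by fun_prop)

theorem isPreconnected_compl_ball {E : Type*} [NormedAddCommGroup E] [NormedSpace ℝ E]
    (h : 1 < Module.rank ℝ E) {ε : ℝ} (hε : 0 < ε) :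
    IsPreconnected (Metric.ball (0 : E) ε)ᶜ := by
  convert isPreconnected_norm_preimage h isPreconnected_Ici (Set.Ici_subset_Ioi.2 hε) using 1
  ext x
  simp

theorem isPreconnected_ball_sdiff_zero {E : Type*} [NormedAddCommGroup E] [NormedSpace ℝ E]
    (h : 1 < Module.rank ℝ E) (ρ : ℝ) : IsPreconnected (Metric.ball (0 : E) ρ \ {0}) := by
  convert isPreconnected_norm_preimage h isPreconnected_Ioo
    (fun _ hx => hx.1 : Set.Ioo 0 ρ ⊆ Set.Ioi (0 : ℝ)) using 1
  ext x
  simp [and_comm]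

/-! ### The hypersurface in a regular level set. -/

theorem exists_component_of_regular_value {n : ℕ} (hn : 2 ≤ n) {r : ℕ∞} (hr : 1 ≤ r)
    {G : Set (EuclideanSpace ℝ (Fin n))} {F : EuclideanSpace ℝ (Fin n) → ℝ}
    (hF : ContDiffOn ℝ (r : WithTop ℕ∞) F G) {ε : ℝ} (hε : 0 < ε)
    (hεG : Metric.closedBall 0 ε ⊆ G) {a : ℝ} (h0a : F 0 < a)
    (hsph : ∀ x ∈ Metric.sphere 0 ε, a < F x) (hreg : IsRegularValueOn G F a) :
    ∃ H, IsConnectedComponentOf H (levelSet G F a) ∧ IsConnected H ∧ IsCompact H ∧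
      IsHypersurface r H ∧ RestrictsOrigin G H ∧ H ⊆ Metric.closedBall 0 ε := by
  have hrank := one_lt_rank_euclideanSpace hn
  have hr' : (1 : WithTop ℕ∞) ≤ (r : WithTop ℕ∞) := by exact_mod_cast hr
  have hballG : Metric.ball 0 ε ⊆ G := Metric.ball_subset_closedBall.trans hεG
  have hFc : ContinuousOn F (Metric.closedBall 0 ε) := hF.continuousOn.mono hεG
  set O : Set (EuclideanSpace ℝ (Fin n)) := Metric.ball 0 ε ∩ F ⁻¹' Set.Iio a with hO
  have hOo : IsOpen O :=
    (hFc.mono Metric.ball_subset_closedBall).isOpen_inter_preimage Metric.isOpen_ball isOpen_Iio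
  have h0O : (0 : EuclideanSpace ℝ (Fin n)) ∈ O := ⟨Metric.mem_ball_self hε, h0a⟩
  set V := connectedComponentIn O 0 with hV
  have hVo : IsOpen V := hOo.connectedComponentIn
  have h0V : (0 : EuclideanSpace ℝ (Fin n)) ∈ V := mem_connectedComponentIn h0O
  have hVO : V ⊆ O := connectedComponentIn_subset _ _
  -- points of the closure of `V`
  have hVcb : closure V ⊆ Metric.closedBall 0 ε :=
    closure_minimal ((hVO.trans Set.inter_subset_left).trans Metric.ball_subset_closedBall)
      Metric.isClosed_closedBall
  have hVle : ∀ x ∈ closure V, F x ≤ a := by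
    have hcl : IsClosed (Metric.closedBall 0 ε ∩ F ⁻¹' Set.Iic a) :=
      hFc.preimage_isClosed_of_isClosed Metric.isClosed_closedBall isClosed_Iic
    have hsub : V ⊆ Metric.closedBall 0 ε ∩ F ⁻¹' Set.Iic a := fun y hy =>
      ⟨Metric.ball_subset_closedBall (hVO hy).1, show F y ≤ a from le_of_lt (hVO hy).2⟩
    exact fun x hx => (closure_minimal hsub hcl hx).2
  have hVball : closure V ⊆ Metric.ball 0 ε := by
    intro x hx
    by_contra hxb
    have : x ∈ Metric.sphere 0 ε := by
      rw [mem_sphere_zero_iff_norm]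
      exact le_antisymm (by simpa using hVcb hx) (by simpa using hxb)
    exact (hVle x hx).not_gt (hsph x this)
  -- If `F x < a`, the open component of `x` in `O` meets `V`, hence equals `V`.
  have hVfr : ∀ x ∈ closure V, x ∉ V → F x = a := by
    intro x hx hxV
    refine (hVle x hx).antisymm (not_lt.1 fun hlt => hxV ?_)
    have hxO : x ∈ O := ⟨hVball hx, hlt⟩
    obtain ⟨y, hy, hy'⟩ := mem_closure_iff.1 hx _ hOo.connectedComponentIn
      (mem_connectedComponentIn hxO)
    rw [hV, connectedComponentIn_eq hy', ← connectedComponentIn_eq hy]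
    exact mem_connectedComponentIn hxO
  -- the outer component of the complement
  obtain ⟨z, hz⟩ : (Metric.sphere (0 : EuclideanSpace ℝ (Fin n)) ε).Nonempty :=
    (isConnected_sphere hrank 0 hε.le).nonempty
  have hzout : z ∈ (Metric.ball (0 : EuclideanSpace ℝ (Fin n)) ε)ᶜ := by
    simp [mem_sphere_zero_iff_norm.1 hz]
  set W := connectedComponentIn (closure V)ᶜ z with hW
  have hWo : IsOpen W := isClosed_closure.isOpen_compl.connectedComponentIn
  have houtW : (Metric.ball 0 ε)ᶜ ⊆ W :=
    (isPreconnected_compl_ball hrank hε).subset_connectedComponentIn hzout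
      (Set.compl_subset_compl.2 hVball)
  have hWV : W ⊆ (closure V)ᶜ := connectedComponentIn_subset _ _
  have hVcW : closure V ⊆ Wᶜ := fun x hx hx' => hWV hx' hx
  have hWc : IsPreconnected Wᶜ :=
    isPreconnected_compl_connectedComponentIn_compl
      ⟨⟨0, subset_closure h0V⟩, isPreconnected_connectedComponentIn.closure⟩ isClosed_closure z
  have hfrW : frontier W = closure W ∩ Wᶜ := by rw [hWo.frontier_eq]; rfl
  have hHpre : IsPreconnected (frontier W) := by
    rw [hfrW]
    refine isPreconnected_inter_of_union_eq_univ isClosed_closure hWo.isClosed_compl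
      isPreconnected_connectedComponentIn.closure hWc ?_
    rw [Set.eq_univ_iff_forall]
    exact fun x => (em (x ∈ W)).imp (fun h => subset_closure h) id
  have hHne : (frontier W).Nonempty := by
    rw [nonempty_frontier_iff]
    refine ⟨⟨z, houtW hzout⟩, fun h => ?_⟩
    exact hVcW (subset_closure h0V) (h ▸ Set.mem_univ _)
  have hKball : Wᶜ ⊆ Metric.ball 0 ε := by
    rw [Set.compl_subset_comm]; exact houtW
  have hHball : frontier W ⊆ Metric.ball 0 ε := by
    rw [hfrW]; exact Set.inter_subset_right.trans hKball
  have hHV : frontier W ⊆ closure V := by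
    intro x hx
    by_contra hxV
    rw [hfrW] at hx
    obtain ⟨y, hy, hy'⟩ := mem_closure_iff.1 hx.1 _
      isClosed_closure.isOpen_compl.connectedComponentIn
      (mem_connectedComponentIn (show x ∈ (closure V)ᶜ from hxV))
    refine hx.2 ?_
    rw [hW, connectedComponentIn_eq hy', ← connectedComponentIn_eq hy]
    exact mem_connectedComponentIn hxV
  have hHnV : ∀ x ∈ frontier W, x ∉ V := by
    intro x hx hxV
    rw [hfrW] at hx
    obtain ⟨y, hy, hy'⟩ := mem_closure_iff.1 hx.1 _ hVo hxV
    exact hWV hy' (subset_closure hy)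
  have hHF : ∀ x ∈ frontier W, F x = a := fun x hx => hVfr x (hHV hx) (hHnV x hx)
  have hHlev : frontier W ⊆ levelSet G F a := fun x hx => ⟨hballG (hHball hx), hHF x hx⟩
  have hder : ∀ x, fderiv ℝ (fun y => F y - a) x = fderiv ℝ F x := fun x => fderiv_sub_const a
  have hga : ContDiffOn ℝ r (fun y => F y - a) G := hF.sub contDiffOn_const
  -- This makes `frontier W` relatively open in the level set.
  have hlocal : ∀ p ∈ frontier W, ∃ N, IsOpen N ∧ p ∈ N ∧ N ⊆ G ∧
      N ∩ levelSet G F a ⊆ frontier W := by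
    intro p hp
    obtain ⟨N, hNo, hpN, hNb, hN⟩ := exists_nhds_isPreconnected_sides Metric.isOpen_ball
      ((hga.of_le hr').mono hballG) (hHball hp) (by rw [hder]; exact hreg p (hHlev hp))
    refine ⟨N, hNo, hpN, hNb.trans hballG, ?_⟩
    obtain ⟨hneg, hnegcl⟩ := hN (-1) (by norm_num)
    obtain ⟨hpos, hposcl⟩ := hN 1 one_ne_zero
    have hsubV : N ∩ {x | 0 < -1 * (F x - a)} ⊆ V := by
      obtain ⟨y, hyN, hyV⟩ := mem_closure_iff.1 (hHV hp) N hNo hpN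
      have hya : F y < a := (hVO hyV).2
      rw [hV, connectedComponentIn_eq hyV]
      refine hneg.subset_connectedComponentIn ⟨hyN, ?_⟩ ?_
      · change 0 < -1 * (F y - a); linarith
      · rintro x ⟨hxN, hx⟩
        have hx' : 0 < -1 * (F x - a) := hx
        exact ⟨hNb hxN, show F x < a by linarith⟩
    have hzeroV : N ∩ {x | F x - a = 0} ⊆ closure V := hnegcl.trans (closure_mono hsubV)
    -- `W` meets `N` and avoids `closure V`, which contains the negative side and the zero set, so
    -- it meets the positive side; that side is connected and misses `closure V`.
    have hsubW : N ∩ {x | 0 < 1 * (F x - a)} ⊆ W := by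
      obtain ⟨y, hyN, hyW⟩ := mem_closure_iff.1 (frontier_subset_closure hp) N hNo hpN
      have hya : 0 < 1 * (F y - a) := by
        rcases lt_trichotomy (F y) a with h | h | h
        · exact absurd (subset_closure (hsubV ⟨hyN, show 0 < -1 * (F y - a) by linarith⟩))
            (hWV hyW)
        · exact absurd (hzeroV ⟨hyN, sub_eq_zero.2 h⟩) (hWV hyW)
        · linarith
      rw [hW, connectedComponentIn_eq hyW]
      refine hpos.subset_connectedComponentIn ⟨hyN, hya⟩ ?_
      rintro x ⟨-, hx⟩ hxV
      have hx' : 0 < 1 * (F x - a) := hx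
      have := hVle x hxV
      linarith
    rintro q ⟨hqN, -, hqa⟩
    have hq : q ∈ N ∩ {x | F x - a = 0} := ⟨hqN, sub_eq_zero.2 hqa⟩
    rw [hfrW]
    exact ⟨closure_mono hsubW (hposcl hq), hVcW (hzeroV hq)⟩
  have hK : IsCompact Wᶜ := Metric.isCompact_of_isClosed_isBounded hWo.isClosed_compl
    (Metric.isBounded_ball.subset hKball)
  obtain ⟨p, hp⟩ := hHne
  refine ⟨frontier W, ⟨p, hHlev hp, ?_⟩, ⟨⟨p, hp⟩, hHpre⟩, ?_, ?_, ⟨?_, ?_, Wᶜ, hK, ?_, ?_⟩, ?_⟩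
  · refine (hHpre.subset_connectedComponentIn hp hHlev).antisymm ?_
    -- The component cannot leave `frontier W`: the union of the `N q` and the complement of
    -- `frontier W` are open, cover it, and are disjoint on the level set.
    choose! N hNo hpN hNG hN using hlocal
    intro x hx
    by_contra hxW
    obtain ⟨y, hy, hyN, hyW⟩ := isPreconnected_connectedComponentIn (F := levelSet G F a) (x := p)
      (⋃ q ∈ frontier W, N q) (frontier W)ᶜ (isOpen_biUnion hNo) isClosed_frontier.isOpen_compl
      (fun y _ => (em (y ∈ frontier W)).imp (fun h => Set.mem_biUnion h (hpN y h)) id)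
      ⟨p, mem_connectedComponentIn (hHlev hp), Set.mem_biUnion hp (hpN p hp)⟩ ⟨x, hx, hxW⟩
    obtain ⟨q, hq, hyq⟩ := Set.mem_iUnion₂.1 hyN
    exact hyW (hN q hq ⟨hyq, connectedComponentIn_subset _ _ hy⟩)
  · exact hK.of_isClosed_subset isClosed_frontier (hfrW ▸ Set.inter_subset_right)
  · intro q hq
    obtain ⟨N, hNo, hqN, hNG, hN⟩ := hlocal q hq
    obtain ⟨j, hj⟩ := exists_single_ne_zero (hreg q (hHlev hq))
    obtain ⟨φ, hqφ, hφN, hφ1, hφ2, hφ⟩ := exists_chart_of_partial_ne_zero hr' hNo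
      (hga.mono hNG) hqN (by rw [hder]; exact hj)
    refine ⟨φ, j, hqφ, hφ1, hφ2, fun x hx => ?_⟩
    rw [(hφ x hx).1, sub_eq_zero]
    exact ⟨fun h => hHF x h, fun h => hN ⟨hφN hx, hNG (hφN hx), h⟩⟩
  · exact hHlev.trans fun x hx => hx.1
  · exact fun h => hHnV 0 h h0V
  · exact hVcW (subset_closure h0V)
  · rw [frontier_compl]
  · exact hHball.trans Metric.ball_subset_closedBall

/-! ### Null images under maps that are flat to the order of the dimension. -/

-- At small scales `h` is Hölder of exponent `d` with constant `ε`, so it maps `d`-dimensional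
-- Hausdorff measure to length with factor `ε`, and `ε` is arbitrary.
open MeasureTheory in
theorem volume_image_eq_zero_of_isLittleO_of_isBounded {d : ℕ} (hd : d ≠ 0)
    {B : Set (EuclideanSpace ℝ (Fin d))} (hB : Bornology.IsBounded B)
    {h : EuclideanSpace ℝ (Fin d) → ℝ}
    (H : ∀ x ∈ B, (fun y => h y - h x) =o[𝓝[B] x] fun y => ‖y - x‖ ^ d) :
    volume (h '' B) = 0 := by
  let μ : Measure (EuclideanSpace ℝ (Fin d)) := Measure.hausdorffMeasure d
  obtain ⟨R, hR⟩ := hB.subset_closedBall 0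
  have hfin : μ (Metric.closedBall 0 R) < ⊤ := (isCompact_closedBall 0 R).measure_lt_top
  have key : ∀ ε : NNReal, 0 < ε → volume (h '' B) ≤ ε * μ (Metric.closedBall 0 R) := by
    intro ε hε
    -- The points where the `ε`-estimate already holds at scale `1 / (N + 1)`.
    let D : ℕ → Set (EuclideanSpace ℝ (Fin d)) := fun N =>
      {x ∈ B | ∀ y ∈ B, dist y x < 1 / (N + 1) → ‖h y - h x‖ ≤ ε * ‖y - x‖ ^ d}
    have hmono : Monotone D := by
      intro N N' hNN x hx
      refine ⟨hx.1, fun y hy hyx => hx.2 y hy (hyx.trans_le ?_)⟩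
      have : (N : ℝ) ≤ N' := by exact_mod_cast hNN
      gcongr
    have hBD : B ⊆ ⋃ N, D N := by
      intro x hx
      have h1 := (H x hx).def (show (0 : ℝ) < ε from hε)
      rw [Filter.Eventually, Metric.mem_nhdsWithin_iff] at h1
      obtain ⟨δ, hδ, h1⟩ := h1
      obtain ⟨N, hN⟩ := exists_nat_one_div_lt hδ
      refine Set.mem_iUnion.2 ⟨N, hx, fun y hy hyx => ?_⟩
      have := h1 ⟨hyx.trans hN, hy⟩
      simpa using this
    have hDN : ∀ N, volume (h '' D N) ≤ ε * μ (Metric.closedBall 0 R) := by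
      intro N
      have hN : (0 : ℝ) < 1 / (N + 1) := by positivity
      -- Half the scale as radius puts any two points of a piece within `1 / (N + 1)`. The pieces
      -- are disjoint and measurable, so the bounds sum even if `D N` is not measurable.
      let b : ℕ → Set (EuclideanSpace ℝ (Fin d)) := fun i =>
        Metric.ball (TopologicalSpace.denseSeq _ i) (1 / (N + 1) / 2)
      have hb : ⋃ i, disjointed b i = Set.univ := by
        rw [iUnion_disjointed, Set.eq_univ_iff_forall]
        intro x
        obtain ⟨i, hi⟩ := (TopologicalSpace.denseRange_denseSeq
          (EuclideanSpace ℝ (Fin d))).exists_dist_lt x (half_pos hN)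
        exact Set.mem_iUnion.2 ⟨i, hi⟩
      have hmeas : ∀ i, MeasurableSet (disjointed b i) :=
        fun i => MeasurableSet.disjointed (fun i => Metric.isOpen_ball.measurableSet) i
      have hpiece : ∀ i, volume (h '' (D N ∩ disjointed b i)) ≤
          ε * μ (Metric.closedBall 0 R ∩ disjointed b i) := by
        intro i
        have hh : HolderOnWith ε (d : NNReal) h (D N ∩ disjointed b i) := by
          intro x hx y hy
          have hxb : dist x (TopologicalSpace.denseSeq _ i) < 1 / (N + 1) / 2 :=
            disjointed_subset b i hx.2
          have hyb : dist y (TopologicalSpace.denseSeq _ i) < 1 / (N + 1) / 2 :=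
            disjointed_subset b i hy.2
          have hxy : dist x y < 1 / (N + 1) :=
            (dist_triangle_right x y _).trans_lt ((add_lt_add hxb hyb).trans_eq (add_halves _))
          have := hy.1.2 x hx.1.1 hxy
          rw [edist_dist, edist_dist, NNReal.coe_natCast, ENNReal.rpow_natCast,
            ← ENNReal.ofReal_pow dist_nonneg, ← ENNReal.ofReal_coe_nnreal,
            ← ENNReal.ofReal_mul ε.coe_nonneg]
          refine ENNReal.ofReal_le_ofReal ?_
          rwa [dist_eq_norm, dist_eq_norm]
        have h2 := hh.hausdorffMeasure_image_le (d := 1)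
          (by exact_mod_cast Nat.pos_of_ne_zero hd) zero_le_one
        rw [hausdorffMeasure_real, ENNReal.rpow_one, mul_one, NNReal.coe_natCast] at h2
        refine h2.trans ?_
        gcongr
        exact fun x hx => hR hx.1
      calc volume (h '' D N) = volume (⋃ i, h '' (D N ∩ disjointed b i)) := by
            rw [← Set.image_iUnion, ← Set.inter_iUnion, hb, Set.inter_univ]
        _ ≤ ∑' i, volume (h '' (D N ∩ disjointed b i)) := measure_iUnion_le _
        _ ≤ ∑' i, ε * μ (Metric.closedBall 0 R ∩ disjointed b i) := ENNReal.tsum_le_tsum hpiece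
        _ = ε * μ (Metric.closedBall 0 R) := by
            rw [ENNReal.tsum_mul_left, ← measure_iUnion, ← Set.inter_iUnion, hb, Set.inter_univ]
            · exact fun i j hij => (disjoint_disjointed b hij).mono
                Set.inter_subset_right Set.inter_subset_right
            · exact fun i => Metric.isClosed_closedBall.measurableSet.inter (hmeas i)
    calc volume (h '' B) ≤ volume (⋃ N, h '' D N) := by
          rw [← Set.image_iUnion]; exact measure_mono (Set.image_mono hBD)
      _ = ⨆ N, volume (h '' D N) :=
          Monotone.measure_iUnion fun N N' hNN => Set.image_mono (hmono hNN)
      _ ≤ _ := iSup_le hDN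
  by_contra hne
  have hpos : 0 < volume (h '' B) := pos_iff_ne_zero.2 hne
  obtain ⟨ε, hε, hlt⟩ := ENNReal.exists_nnreal_pos_mul_lt hfin.ne hpos.ne'
  exact (key ε hε).not_gt hlt

open MeasureTheory in
theorem volume_image_eq_zero_of_isLittleO {d : ℕ} {B : Set (EuclideanSpace ℝ (Fin d))}
    {h : EuclideanSpace ℝ (Fin d) → ℝ}
    (H : ∀ x ∈ B, (fun y => h y - h x) =o[𝓝[B] x] fun y => ‖y - x‖ ^ d) :
    volume (h '' B) = 0 := by
  rcases eq_or_ne d 0 with rfl | hd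
  · exact (Set.subsingleton_of_subsingleton.image h).measure_zero _
  · rw [← Set.inter_univ B, ← Metric.iUnion_closedBall_nat 0, Set.inter_iUnion, Set.image_iUnion]
    refine measure_iUnion_null fun R => volume_image_eq_zero_of_isLittleO_of_isBounded hd
      (Metric.isBounded_closedBall.subset Set.inter_subset_right) fun x hx => ?_
    exact (H x hx.1).mono (nhdsWithin_mono _ Set.inter_subset_left)

/-! ### Flat pieces and the Morse–Sard theorem. -/

theorem isLittleO_sub_of_isLittleO_fderiv {E : Type*} [NormedAddCommGroup E] [NormedSpace ℝ E]
    {h : E → ℝ} {x : E} {k : ℕ} (hd : ∀ᶠ y in 𝓝 x, DifferentiableAt ℝ h y)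
    (H : (fun y => fderiv ℝ h y) =o[𝓝 x] fun y => ‖y - x‖ ^ k) :
    (fun y => h y - h x) =o[𝓝 x] fun y => ‖y - x‖ ^ (k + 1) := by
  rw [Asymptotics.isLittleO_iff]
  intro c hc
  obtain ⟨δ, hδ, hball⟩ := Metric.eventually_nhds_iff_ball.1 (hd.and (H.def hc))
  filter_upwards [Metric.ball_mem_nhds x hδ] with y hy
  have hsub : Metric.closedBall x ‖y - x‖ ⊆ Metric.ball x δ :=
    Metric.closedBall_subset_ball (by simpa [dist_eq_norm] using hy)
  have hmv := (convex_closedBall x ‖y - x‖).norm_image_sub_le_of_norm_fderiv_le (𝕜 := ℝ)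
    (f := h) (C := c * ‖y - x‖ ^ k) (x := x) (y := y) (fun z hz => (hball z (hsub hz)).1)
    (fun z hz => ?_) (by simp) (by simp [dist_eq_norm])
  · rw [norm_pow, norm_norm, pow_succ, ← mul_assoc]
    exact hmv
  · refine (hball z (hsub hz)).2.trans ?_
    rw [norm_pow, norm_norm]
    have : ‖z - x‖ ≤ ‖y - x‖ := by simpa [dist_eq_norm] using hz
    gcongr

theorem isLittleO_comp_sub_of_partials {d n k : ℕ} {g : EuclideanSpace ℝ (Fin n) → ℝ}
    {ψ : EuclideanSpace ℝ (Fin d) → EuclideanSpace ℝ (Fin n)} {x : EuclideanSpace ℝ (Fin d)}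
    (hg : ContDiffAt ℝ 1 g (ψ x)) (hψ : ContDiffAt ℝ 1 ψ x)
    (H : ∀ j, (fun y => fderiv ℝ g (ψ y) (EuclideanSpace.single j 1)) =o[𝓝 x]
      fun y => ‖y - x‖ ^ k) :
    (fun y => g (ψ y) - g (ψ x)) =o[𝓝 x] fun y => ‖y - x‖ ^ (k + 1) := by
  have hgd : ∀ᶠ y in 𝓝 x, DifferentiableAt ℝ g (ψ y) :=
    hψ.continuousAt.eventually ((hg.eventually (by simp)).mono
      fun z hz => hz.differentiableAt one_ne_zero)
  have hψd : ∀ᶠ y in 𝓝 x, DifferentiableAt ℝ ψ y :=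
    (hψ.eventually (by simp)).mono fun z hz => hz.differentiableAt one_ne_zero
  refine isLittleO_sub_of_isLittleO_fderiv (h := fun y => g (ψ y)) ?_ ?_
  · filter_upwards [hgd, hψd] with y h1 h2 using h1.comp y h2
  have hsum : (fun y => fderiv ℝ g (ψ y)) =o[𝓝 x] fun y => ‖y - x‖ ^ k := by
    have hrep : ∀ L : EuclideanSpace ℝ (Fin n) →L[ℝ] ℝ, L = ∑ j,
        L (EuclideanSpace.single j 1) •
          (EuclideanSpace.proj j : EuclideanSpace ℝ (Fin n) →L[ℝ] ℝ) := by
      intro L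
      refine ContinuousLinearMap.coe_injective
        ((EuclideanSpace.basisFun (Fin n) ℝ).toBasis.ext fun i => ?_)
      simp [Finset.sum_apply]
    rw [show (fun y => fderiv ℝ g (ψ y)) = fun y => ∑ j, fderiv ℝ g (ψ y)
      (EuclideanSpace.single j 1) • (EuclideanSpace.proj j : EuclideanSpace ℝ (Fin n) →L[ℝ] ℝ)
      from funext fun y => hrep _]
    refine Asymptotics.IsLittleO.fun_sum fun j _ => ?_
    refine Asymptotics.IsBigO.trans_isLittleO (Asymptotics.IsBigO.of_bound
      ‖(EuclideanSpace.proj j : EuclideanSpace ℝ (Fin n) →L[ℝ] ℝ)‖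
      (Eventually.of_forall fun y => ?_)) (H j)
    rw [norm_smul, mul_comm]
  have hbd : (fun y => fderiv ℝ ψ y) =O[𝓝 x] fun _ => (1 : ℝ) :=
    (hψ.continuousAt_fderiv one_ne_zero).isBigO_one ℝ
  have hmul := hsum.norm_left.mul_isBigO hbd.norm_left
  simp only [mul_one] at hmul
  refine Asymptotics.IsBigO.trans_isLittleO (Asymptotics.IsBigO.of_bound 1 ?_) hmul
  filter_upwards [hgd, hψd] with y h1 h2
  rw [fderiv_fun_comp y h1 h2, one_mul, norm_mul, norm_norm, norm_norm]
  exact ContinuousLinearMap.opNorm_comp_le _ _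

/-- `S` is a parametrized piece of `A ⊆ ℝⁿ`, of dimension at most `n`, along which every `C^k`
function vanishing on `A` vanishes to order `k`. -/
def IsFlatPiece (k : ℕ) {n : ℕ} (A S : Set (EuclideanSpace ℝ (Fin n))) : Prop :=
  ∃ d ≤ n, ∃ (ψ : EuclideanSpace ℝ (Fin d) → EuclideanSpace ℝ (Fin n))
    (B : Set (EuclideanSpace ℝ (Fin d))), S = ψ '' B ∧ S ⊆ A ∧ (∀ x ∈ B, ContDiffAt ℝ 1 ψ x) ∧
    ∀ g : EuclideanSpace ℝ (Fin n) → ℝ, (∀ x ∈ A, ContDiffAt ℝ k g x ∧ g x = 0) →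
      ∀ x ∈ B, (fun y => g (ψ y)) =o[𝓝 x] fun y => ‖y - x‖ ^ k

/-- `X` is covered by countably many flat pieces of `A`. -/
def HasFlatCover (k : ℕ) {n : ℕ} (A X : Set (EuclideanSpace ℝ (Fin n))) : Prop :=
  ∃ 𝒮 : Set (Set (EuclideanSpace ℝ (Fin n))), 𝒮.Countable ∧ (∀ S ∈ 𝒮, IsFlatPiece k A S) ∧
    X ⊆ ⋃₀ 𝒮

theorem IsFlatPiece.image {k n m : ℕ} (hk : 1 ≤ k) (hmn : m ≤ n)
    {A₀ S : Set (EuclideanSpace ℝ (Fin m))} {A : Set (EuclideanSpace ℝ (Fin n))}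
    {ψ₀ : EuclideanSpace ℝ (Fin m) → EuclideanSpace ℝ (Fin n)}
    (hψ₀ : ∀ x ∈ A₀, ContDiffAt ℝ k ψ₀ x) (hA : Set.MapsTo ψ₀ A₀ A) (h : IsFlatPiece k A₀ S) :
    IsFlatPiece k A (ψ₀ '' S) := by
  obtain ⟨d, hd, ψ, B, rfl, hSA, hψ, hg⟩ := h
  refine ⟨d, hd.trans hmn, ψ₀ ∘ ψ, B, (Set.image_comp ψ₀ ψ B).symm, ?_, fun x hx => ?_,
    fun g hgA x hx => ?_⟩
  · rintro _ ⟨y, hy, rfl⟩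
    exact hA (hSA hy)
  · exact ((hψ₀ _ (hSA ⟨x, hx, rfl⟩)).of_le (by exact_mod_cast hk)).comp x (hψ x hx)
  · refine hg (fun y => g (ψ₀ y)) (fun y hy => ?_) x hx
    exact ⟨(hgA _ (hA hy)).1.comp y (hψ₀ y hy), (hgA _ (hA hy)).2⟩

theorem HasFlatCover.image {k n m : ℕ} (hk : 1 ≤ k) (hmn : m ≤ n)
    {A₀ X : Set (EuclideanSpace ℝ (Fin m))} {A : Set (EuclideanSpace ℝ (Fin n))}
    {ψ₀ : EuclideanSpace ℝ (Fin m) → EuclideanSpace ℝ (Fin n)}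
    (hψ₀ : ∀ x ∈ A₀, ContDiffAt ℝ k ψ₀ x) (hA : Set.MapsTo ψ₀ A₀ A) (h : HasFlatCover k A₀ X) :
    HasFlatCover k A (ψ₀ '' X) := by
  obtain ⟨𝒮, hc, h𝒮, hX⟩ := h
  refine ⟨Set.image ψ₀ '' 𝒮, hc.image _, ?_, ?_⟩
  · rintro _ ⟨S, hS, rfl⟩
    exact (h𝒮 S hS).image hk hmn hψ₀ hA
  · rintro _ ⟨x, hx, rfl⟩
    obtain ⟨S, hS, hxS⟩ := hX hx
    exact ⟨ψ₀ '' S, ⟨S, hS, rfl⟩, x, hxS, rfl⟩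

theorem HasFlatCover.mono {k n : ℕ} {A X Y : Set (EuclideanSpace ℝ (Fin n))}
    (h : HasFlatCover k A X) (hYX : Y ⊆ X) : HasFlatCover k A Y := by
  obtain ⟨𝒮, hc, h𝒮, hX⟩ := h
  exact ⟨𝒮, hc, h𝒮, hYX.trans hX⟩

theorem HasFlatCover.biUnion {k n : ℕ} {A : Set (EuclideanSpace ℝ (Fin n))} {ι : Type*}
    {t : Set ι} (ht : t.Countable) {X : ι → Set (EuclideanSpace ℝ (Fin n))}
    (h : ∀ i ∈ t, HasFlatCover k A (X i)) : HasFlatCover k A (⋃ i ∈ t, X i) := by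
  choose! 𝒮 hc h𝒮 hX using h
  refine ⟨⋃ i ∈ t, 𝒮 i, ht.biUnion hc, fun S hS => ?_, fun x hx => ?_⟩
  · obtain ⟨i, hi, hS⟩ := Set.mem_iUnion₂.1 hS
    exact h𝒮 i hi S hS
  · obtain ⟨i, hi, hx⟩ := Set.mem_iUnion₂.1 hx
    obtain ⟨S, hS, hxS⟩ := hX i hi hx
    exact ⟨S, Set.mem_biUnion hi hS, hxS⟩

theorem HasFlatCover.union {k n : ℕ} {A X Y : Set (EuclideanSpace ℝ (Fin n))}
    (hX : HasFlatCover k A X) (hY : HasFlatCover k A Y) : HasFlatCover k A (X ∪ Y) := by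
  obtain ⟨𝒮, hc, h𝒮, hX⟩ := hX
  obtain ⟨𝒯, hc', h𝒯, hY⟩ := hY
  refine ⟨𝒮 ∪ 𝒯, hc.union hc', fun S hS => hS.elim (h𝒮 S) (h𝒯 S), ?_⟩
  rw [Set.sUnion_union]
  exact Set.union_subset_union hX hY

theorem HasFlatCover.of_local {k n : ℕ} {A X : Set (EuclideanSpace ℝ (Fin n))}
    (h : ∀ x ∈ X, ∃ N ∈ 𝓝[X] x, HasFlatCover k A N) : HasFlatCover k A X := by
  choose! N hN hcov using h
  obtain ⟨t, htX, ht, hXt⟩ := TopologicalSpace.countable_cover_nhdsWithin hN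
  exact (HasFlatCover.biUnion ht fun i hi => hcov i (htX hi)).mono hXt

/-- Pieces of the set where the differentials of all `C^(k+1)` functions vanishing on `A` vanish
gain one order of flatness. -/
theorem IsFlatPiece.succ {k n : ℕ} {A S : Set (EuclideanSpace ℝ (Fin n))}
    (h : IsFlatPiece k {x ∈ A | ∀ g : EuclideanSpace ℝ (Fin n) → ℝ,
      (∀ y ∈ A, ContDiffAt ℝ (k + 1 : ℕ) g y ∧ g y = 0) → fderiv ℝ g x = 0} S) :
    IsFlatPiece (k + 1) A S := by
  obtain ⟨d, hd, ψ, B, rfl, hSA, hψ, hg⟩ := h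
  refine ⟨d, hd, ψ, B, rfl, fun x hx => (hSA hx).1, hψ, fun g hgA x hx => ?_⟩
  have hxA := hSA ⟨x, hx, rfl⟩
  have hmain := isLittleO_comp_sub_of_partials (k := k)
    ((hgA _ hxA.1).1.of_le (by exact_mod_cast Nat.le_add_left 1 k)) (hψ x hx) fun j =>
      hg (fun z => fderiv ℝ g z (EuclideanSpace.single j 1)) (fun z hz => ?_) x hx
  · simpa [(hgA _ hxA.1).2] using hmain
  · refine ⟨?_, by rw [hz.2 g hgA]; rfl⟩
    exact ((hgA z hz.1).1.fderiv_right (m := k) (by norm_cast)).clm_apply contDiffAt_const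

/-- Near `x` the set `A` lies in the hypersurface `g = 0`, which a chart identifies with part of a
hyperplane, so the dimension drops by one and `IH` applies. -/
theorem exists_mem_nhds_hasFlatCover {k n : ℕ} {A : Set (EuclideanSpace ℝ (Fin (n + 1)))}
    (IH : ∀ A₀ : Set (EuclideanSpace ℝ (Fin n)), HasFlatCover (k + 1) A₀ A₀)
    {g : EuclideanSpace ℝ (Fin (n + 1)) → ℝ}
    (hgA : ∀ y ∈ A, ContDiffAt ℝ (k + 1 : ℕ) g y ∧ g y = 0)
    {x : EuclideanSpace ℝ (Fin (n + 1))} (hx : x ∈ A) (hgx : fderiv ℝ g x ≠ 0) :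
    ∃ N ∈ 𝓝 x, HasFlatCover (k + 1) A (A ∩ N) := by
  obtain ⟨j, hj⟩ := exists_single_ne_zero hgx
  obtain ⟨U, hU, hxU, hgU⟩ : ∃ U, IsOpen U ∧ x ∈ U ∧ ContDiffOn ℝ (k + 1 : ℕ) g U := by
    obtain ⟨U, hU, hUo, hxU⟩ := mem_nhds_iff.1 ((hgA x hx).1.eventually (by simp))
    exact ⟨U, hUo, hxU, fun y hy => ContDiffAt.contDiffWithinAt (hU hy :)⟩
  obtain ⟨φ, hxφ, -, -, hφs, hφ⟩ := exists_chart_of_partial_ne_zero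
    (by exact_mod_cast Nat.le_add_left 1 k) hU hgU hxU hj
  let ins : EuclideanSpace ℝ (Fin n) → EuclideanSpace ℝ (Fin (n + 1)) :=
    fun y => WithLp.toLp 2 (j.insertNth 0 y)
  have hins : ContDiff ℝ (k + 1 : ℕ) ins := by
    rw [contDiff_euclidean]
    intro i
    refine Fin.succAboveCases j ?_ (fun i => ?_) i
    · simpa [ins] using contDiff_const
    · simpa [ins] using (EuclideanSpace.proj i : EuclideanSpace ℝ (Fin n) →L[ℝ] ℝ).contDiff
  let A₀ : Set (EuclideanSpace ℝ (Fin n)) := {y | ins y ∈ φ.target ∧ φ.symm (ins y) ∈ A}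
  have hcov : HasFlatCover (k + 1) A ((fun y => φ.symm (ins y)) '' A₀) := by
    refine (IH A₀).image (Nat.le_add_left 1 k) n.le_succ (fun y hy => ?_) fun y hy => hy.2
    exact (hφs.contDiffAt (φ.open_target.mem_nhds hy.1)).comp y hins.contDiffAt
  refine ⟨φ.source, φ.open_source.mem_nhds hxφ, hcov.mono ?_⟩
  rintro z ⟨hzA, hz⟩
  let y : EuclideanSpace ℝ (Fin n) := WithLp.toLp 2 fun i => φ z (j.succAbove i)
  have hy : ins y = φ z := by
    ext i
    refine Fin.succAboveCases j ?_ (fun i => ?_) i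
    · simp [ins, (hφ z hz).1, (hgA z hzA).2]
    · simp [ins, y]
  have hsymm : φ.symm (ins y) = z := by rw [hy, φ.left_inv hz]
  exact ⟨y, ⟨hy ▸ φ.map_source hz, hsymm.symm ▸ hzA⟩, hsymm⟩

/-- **Morse's lemma** on vanishing of `C^k` functions: every subset of `ℝⁿ` is a countable union
of flat pieces. -/
theorem hasFlatCover_self (k : ℕ) : ∀ {n : ℕ} (A : Set (EuclideanSpace ℝ (Fin n))),
    HasFlatCover k A A := by
  induction k with
  | zero =>
    intro n A
    refine ⟨{A}, Set.countable_singleton A, ?_, by simp⟩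
    rintro S rfl
    refine ⟨n, le_rfl, id, S, by simp, subset_rfl, fun x _ => contDiffAt_id, fun g hg x hx => ?_⟩
    simp only [pow_zero, Asymptotics.isLittleO_one_iff]
    have := (hg x hx).1.continuousAt.tendsto
    rwa [(hg x hx).2] at this
  | succ k ihk =>
    intro n
    induction n with
    | zero =>
      intro A
      obtain ⟨𝒮, hc, h𝒮, hX⟩ := ihk {x ∈ A | ∀ g : EuclideanSpace ℝ (Fin 0) → ℝ,
        (∀ y ∈ A, ContDiffAt ℝ (k + 1 : ℕ) g y ∧ g y = 0) → fderiv ℝ g x = 0}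
      refine ⟨𝒮, hc, fun S hS => (h𝒮 S hS).succ, fun x hx => hX ⟨hx, fun g _ => ?_⟩⟩
      exact Subsingleton.elim _ _
    | succ n ihn =>
      intro A
      obtain ⟨𝒮, hc, h𝒮, hX⟩ := ihk {x ∈ A | ∀ g : EuclideanSpace ℝ (Fin (n + 1)) → ℝ,
        (∀ y ∈ A, ContDiffAt ℝ (k + 1 : ℕ) g y ∧ g y = 0) → fderiv ℝ g x = 0}
      -- Where all differentials vanish, the order `k` cover gains one order; elsewhere the
      -- dimension drops.
      have hflat : HasFlatCover (k + 1) A _ := ⟨𝒮, hc, fun S hS => (h𝒮 S hS).succ, hX⟩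
      have hrest : HasFlatCover (k + 1) A {x ∈ A | ∃ g : EuclideanSpace ℝ (Fin (n + 1)) → ℝ,
          (∀ y ∈ A, ContDiffAt ℝ (k + 1 : ℕ) g y ∧ g y = 0) ∧ fderiv ℝ g x ≠ 0} := by
        refine HasFlatCover.of_local ?_
        rintro x ⟨hx, g, hgA, hgx⟩
        obtain ⟨N, hN, hcov⟩ := exists_mem_nhds_hasFlatCover ihn hgA hx hgx
        exact ⟨_, Filter.inter_mem (mem_of_superset self_mem_nhdsWithin fun y hy => hy.1)
          (mem_nhdsWithin_of_mem_nhds hN), hcov⟩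
      refine (hflat.union hrest).mono fun x hx => ?_
      by_cases h : ∀ g : EuclideanSpace ℝ (Fin (n + 1)) → ℝ,
        (∀ y ∈ A, ContDiffAt ℝ (k + 1 : ℕ) g y ∧ g y = 0) → fderiv ℝ g x = 0
      · exact Or.inl ⟨hx, h⟩
      · push Not at h
        exact Or.inr ⟨hx, h⟩

/-- **Morse–Sard theorem** for real-valued functions: the set of critical values of a `C^n`
function on an open subset of `ℝⁿ` is a null set. -/
theorem volume_image_critical_eq_zero {n : ℕ} {G : Set (EuclideanSpace ℝ (Fin n))}
    (hG : IsOpen G) {F : EuclideanSpace ℝ (Fin n) → ℝ} (hn : n ≠ 0) (hF : ContDiffOn ℝ n F G) :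
    MeasureTheory.volume (F '' {x ∈ G | fderiv ℝ F x = 0}) = 0 := by
  obtain ⟨k, rfl⟩ := Nat.exists_eq_succ_of_ne_zero hn
  -- The order is `k = n - 1`, the smoothness of the partial derivatives of `F`; integrating along a
  -- piece regains the lost order.
  obtain ⟨𝒮, hc, h𝒮, hX⟩ := hasFlatCover_self k {x ∈ G | fderiv ℝ F x = 0}
  have hFat : ∀ x ∈ G, ContDiffAt ℝ (k + 1 : ℕ) F x := fun x hx => hF.contDiffAt (hG.mem_nhds hx)
  refine MeasureTheory.measure_mono_null (Set.image_mono hX) ?_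
  rw [Set.sUnion_eq_biUnion, Set.image_iUnion₂, MeasureTheory.measure_biUnion_null_iff hc]
  intro S hS
  obtain ⟨d, hd, ψ, B, rfl, hSA, hψ, hg⟩ := h𝒮 S hS
  rw [← Set.image_comp]
  refine volume_image_eq_zero_of_isLittleO fun x hx =>
    Asymptotics.IsLittleO.mono ?_ nhdsWithin_le_nhds
  have hxA := hSA ⟨x, hx, rfl⟩
  have hmain := isLittleO_comp_sub_of_partials (k := k)
    ((hFat _ hxA.1).of_le (by exact_mod_cast Nat.le_add_left 1 k)) (hψ x hx) fun j =>
      hg (fun z => fderiv ℝ F z (EuclideanSpace.single j 1)) (fun z hz => ?_) x hx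
  -- As `d ≤ k + 1`, flatness of order `k + 1` implies flatness of order `d`.
  · refine hmain.trans_isBigO (Asymptotics.IsBigO.of_bound 1 ?_)
    filter_upwards [Metric.ball_mem_nhds x one_pos] with y hy
    rw [one_mul, norm_pow, norm_pow, norm_norm]
    exact pow_le_pow_of_le_one (norm_nonneg _) (by simpa [dist_eq_norm] using hy.le) hd
  · refine ⟨?_, by rw [hz.2]; rfl⟩
    exact ((hFat z hz.1).fderiv_right (m := k) (by norm_cast)).clm_apply contDiffAt_const

theorem exists_isRegularValueOn_mem_Ioo {n : ℕ} {G : Set (EuclideanSpace ℝ (Fin n))}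
    (hG : IsOpen G) {F : EuclideanSpace ℝ (Fin n) → ℝ} (hn : n ≠ 0) (hF : ContDiffOn ℝ n F G)
    {b c : ℝ} (hbc : b < c) : ∃ a ∈ Set.Ioo b c, IsRegularValueOn G F a := by
  by_contra! h
  have hsub : Set.Ioo b c ⊆ F '' {x ∈ G | fderiv ℝ F x = 0} := by
    intro a ha
    have := h a ha
    simp only [IsRegularValueOn, not_forall, not_not] at this
    obtain ⟨x, hx, hx0⟩ := this
    exact ⟨x, ⟨hx.1, hx0⟩, hx.2⟩
  have h0 := MeasureTheory.measure_mono_null hsub (volume_image_critical_eq_zero hG hn hF)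
  rw [Real.volume_Ioo, ENNReal.ofReal_eq_zero] at h0
  linarith

/-! ### Small components near an isolated zero. -/

theorem exists_small_component_of_pos {n : ℕ} (hn : 2 ≤ n) {r : ℕ∞} (hr : (n : ℕ∞) ≤ r)
    {G : Set (EuclideanSpace ℝ (Fin n))} (hG : IsOpen G) {F : EuclideanSpace ℝ (Fin n) → ℝ}
    (hF : ContDiffOn ℝ (r : WithTop ℕ∞) F G) (hF0 : F 0 = 0) {ρ : ℝ} (hρ : 0 < ρ)
    (hρG : Metric.ball 0 ρ ⊆ G) (hpos : ∀ x ∈ Metric.ball 0 ρ, x ≠ 0 → 0 < F x) {ε : ℝ}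
    (hε : 0 < ε) :
    ∃ a H, |a| < ε ∧ IsRegularValueOn G F a ∧ (IsConnectedComponentOf H (levelSet G F a) ∧
      IsConnected H ∧ IsCompact H ∧ IsHypersurface r H ∧ RestrictsOrigin G H) ∧
      H ⊆ Metric.closedBall 0 ε := by
  have hrank := one_lt_rank_euclideanSpace hn
  set δ := min (ρ / 2) ε with hδdef
  have hδ : 0 < δ := lt_min (half_pos hρ) hε
  have hδρ : Metric.closedBall (0 : EuclideanSpace ℝ (Fin n)) δ ⊆ Metric.ball 0 ρ :=
    Metric.closedBall_subset_ball ((min_le_left _ _).trans_lt (half_lt_self hρ))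
  have hδG := hδρ.trans hρG
  obtain ⟨z, hz, hzmin⟩ := (isCompact_sphere (0 : EuclideanSpace ℝ (Fin n)) δ).exists_isMinOn
    (isConnected_sphere hrank 0 hδ.le).nonempty
    (hF.continuousOn.mono (Metric.sphere_subset_closedBall.trans hδG))
  have hFz : 0 < F z := hpos z (hδρ (Metric.sphere_subset_closedBall hz))
    (ne_zero_of_mem_sphere hδ.ne' ⟨z, hz⟩)
  have hrn : ((n : ℕ) : WithTop ℕ∞) ≤ (r : WithTop ℕ∞) := by exact_mod_cast hr
  -- Below `F z`, the minimum on the sphere, so that the component is trapped; below `ε`, so that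
  -- the values tend to `0`.
  obtain ⟨a, ⟨ha0, ha⟩, hreg⟩ := exists_isRegularValueOn_mem_Ioo hG (by omega) (hF.of_le hrn)
    (lt_min hFz hε)
  have hr1 : 1 ≤ r := le_trans (by exact_mod_cast (by omega : 1 ≤ n)) hr
  obtain ⟨H, h1, h2, h3, h4, h5, h6⟩ := exists_component_of_regular_value hn hr1 hF hδ hδG
    (hF0.trans_lt ha0) (fun x hx => (ha.trans_le (min_le_left _ _)).trans_le (hzmin hx)) hreg
  exact ⟨a, H, by rw [abs_of_pos ha0]; exact ha.trans_le (min_le_right _ _), hreg,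
    ⟨h1, h2, h3, h4, h5⟩, h6.trans (Metric.closedBall_subset_closedBall (min_le_right _ _))⟩

theorem exists_small_component {n : ℕ} (hn : 2 ≤ n) {r : ℕ∞} (hr : (n : ℕ∞) ≤ r)
    {G : Set (EuclideanSpace ℝ (Fin n))} (hG : IsOpen G) {F : EuclideanSpace ℝ (Fin n) → ℝ}
    (hF : ContDiffOn ℝ (r : WithTop ℕ∞) F G) (hF0 : F 0 = 0) {ρ : ℝ} (hρ : 0 < ρ)
    (hρG : Metric.ball 0 ρ ⊆ G) (hne : ∀ x ∈ Metric.ball 0 ρ, x ≠ 0 → F x ≠ 0) {ε : ℝ}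
    (hε : 0 < ε) :
    ∃ a H, |a| < ε ∧ IsRegularValueOn G F a ∧ (IsConnectedComponentOf H (levelSet G F a) ∧
      IsConnected H ∧ IsCompact H ∧ IsHypersurface r H ∧ RestrictsOrigin G H) ∧
      H ⊆ Metric.closedBall 0 ε := by
  have hrank := one_lt_rank_euclideanSpace hn
  have hconn : IsPreconnected (Metric.ball (0 : EuclideanSpace ℝ (Fin n)) ρ \ {0}) :=
    isPreconnected_ball_sdiff_zero hrank ρ
  have hsign : (∀ x ∈ Metric.ball (0 : EuclideanSpace ℝ (Fin n)) ρ, x ≠ 0 → 0 < F x) ∨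
      ∀ x ∈ Metric.ball (0 : EuclideanSpace ℝ (Fin n)) ρ, x ≠ 0 → 0 < -F x := by
    by_contra! h
    obtain ⟨⟨x, hx, hx0, hFx⟩, y, hy, hy0, hFy⟩ := h
    obtain ⟨w, hw, hFw⟩ := hconn.intermediate_value (f := F) ⟨hx, hx0⟩ ⟨hy, hy0⟩
      (hF.continuousOn.mono (Set.sdiff_subset.trans hρG)) ⟨hFx, by linarith⟩
    exact hne w hw.1 hw.2 hFw
  rcases hsign with hpos | hneg
  · exact exists_small_component_of_pos hn hr hG hF hF0 hρ hρG hpos hε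
  · obtain ⟨a, H, ha, hreg, hH, hHε⟩ := exists_small_component_of_pos hn hr hG hF.neg
      (by simpa using hF0) hρ hρG hneg hε
    have hlev : levelSet G (fun x => -F x) a = levelSet G F (-a) := by
      ext x
      simp [levelSet, neg_eq_iff_eq_neg]
    rw [hlev] at hH
    refine ⟨-a, H, by rwa [abs_neg], fun x hx => ?_, hH, hHε⟩
    have := hreg x (hlev ▸ hx)
    rwa [fderiv_fun_neg, neg_ne_zero] at this

theorem lemma2p2 (n : ℕ) (hn : 2 ≤ n) (r : ℕ∞) (hr : (n : ℕ∞) ≤ r)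
    (G : Set (EuclideanSpace ℝ (Fin n))) (hG : IsOpen G)
    (h0 : (0 : EuclideanSpace ℝ (Fin n)) ∈ G)
    (F : EuclideanSpace ℝ (Fin n) → ℝ) (hF : ContDiffOn ℝ (r : WithTop ℕ∞) F G)
    (hF0 : F 0 = 0)
    (hiso : IsIsolatedComponentOf {(0 : EuclideanSpace ℝ (Fin n))} (levelSet G F 0)) :
    ConditionL r G F := by
  obtain ⟨-, U, hU, h0U, hUF⟩ := hiso
  obtain ⟨ρ, hρ, hball⟩ := Metric.isOpen_iff.1 (hG.inter hU) 0 ⟨h0, h0U rfl⟩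
  have hne : ∀ x ∈ Metric.ball 0 ρ, x ≠ 0 → F x ≠ 0 := by
    intro x hx hx0 hFx
    have : x ∈ U ∩ levelSet G F 0 := ⟨(hball hx).2, (hball hx).1, hFx⟩
    rw [hUF] at this
    exact hx0 this
  have hε : ∀ i : ℕ, (0 : ℝ) < 1 / (i + 1) := fun i => by positivity
  choose a H ha hreg hH hHε using fun i : ℕ => exists_small_component hn hr hG hF hF0 hρ
    (hball.trans Set.inter_subset_left) hne (hε i)
  have hlim := tendsto_one_div_add_atTop_nhds_zero_nat (𝕜 := ℝ)
  refine ⟨a, H, hreg, squeeze_zero_norm (fun i => (ha i).le) hlim, hH, ?_⟩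
  refine squeeze_zero (fun i => Metric.diam_nonneg) (fun i => ?_)
    (by simpa using hlim.const_mul 2 : Tendsto (fun i : ℕ => 2 * (1 / ((i : ℝ) + 1))) atTop (𝓝 0))
  exact (Metric.diam_mono (hHε i) Metric.isBounded_closedBall).trans
    (Metric.diam_closedBall (hε i).le)
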